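/- **Dual index coding problem.** Let $N$ be a nonnegative integer, and let rates $S_{J} \ge 0$ be given for all nonempty $J \subseteq \{1,\dots,N\}$. There are $2^N-1$ senders, one for each such $J$. For block length $n$ and nonnegative rates $R=(R_1,\dots,R_N)$, the message tuple $(M_1,\dots,M_N)$ is uniformly distributed over $\prod_{j=1}^N \{1,\dots,\lfloor 2^{nR_j}\rfloor\}$. Sender $J$ encodes the subtuple $M_{J}=(M_j : j\in J)$ into an index $W_{J}=w_J(M_{J}) \in \{1,\dots,\lfloor 2^{nS_{J}}\rfloor\}$. A common receiver observes all the indices $(W_{J})_{J\neq\emptyset}$ without noise and forms an estimate $(\hat M_1,\dots,\hat M_N)$ of the message tuple (or declares an error). A tuple $R$ is *achievable* if there is a sequence of such codes, one for each block length $n$, with $P\{(\hat M_1,\dots,\hat M_N)\ne(M_1,\dots,M_N)\}\to 0$ as $n\to\infty$. The *capacity region* is the closure of the set of achievable rate tuples. *Flat coding with simultaneous decoding* is the following random coding scheme: the indices $w_{J}(m_{J})$, over all nonempty $J$ and all subtuples $m_{J}$, are drawn independently, each uniformly from $\{1,\dots,\lfloor 2^{nS_{J}}\rfloor\}$. The receiver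 outputs the unique message tuple $\hat m$ such that $w_{J}(\hat m_{J})$ equals the received index for all nonempty $J$ simultaneously, and declares an error if there is no such tuple or more than one. A tuple $R$ of nonnegative rates is *achievable by flat coding* if the probability of error of this scheme, averaged over the random choice of the code, tends to $0$ as $n\to\infty$. **Proposition.** The capacity region of the dual index coding problem is the set $\mathscr{R}$ of all tuples $(R_1,\dots,R_N)$ of nonnegative reals such that $$\sum_{j\in J} R_j \;\le\; \sum_{J' \subseteq \{1,\dots,N\}\,:\, J'\cap J\neq\emptyset} S_{J'} \qquad\text{for all } J\subseteq\{1,\dots,N\}.$$ Moreover, this region is achieved by flat coding with simultaneous decoding: every nonnegative tuple that satisfies these inequalities strictly for all nonempty $J$ is achievable by flat coding, and the closure of the set of rate tuples that are achievable by flat coding is equal to $\mathscr{R}$. -/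

import Mathlib

open MeasureTheory ProbabilityTheory Filter Topology

noncomputable section

namespace DualIndexCoding

/-- The `2 ^ N - 1` senders: one for each nonempty set `J` of message indices. -/
abbrev Sender (N : ℕ) : Type := {J : Finset (Fin N) // J.Nonempty}

/-- The number of integers in `{1, …, 2 ^ (n r)}`, that is, `⌊2 ^ (n r)⌋`. -/
def setSize (n : ℕ) (r : ℝ) : ℕ := ⌊(2 : ℝ) ^ ((n : ℝ) * r)⌋₊

/-- The message tuples `(m_1, …, m_N)`, where `m_j` ranges over a set of `⌊2 ^ (n R_j)⌋`
elements. -/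
abbrev Messages {N : ℕ} (n : ℕ) (R : Fin N → ℝ) : Type :=
  ∀ j : Fin N, Fin (setSize n (R j))

/-- The subtuples `m_J = (m_j : j ∈ J)`. -/
abbrev SubMessages {N : ℕ} (n : ℕ) (R : Fin N → ℝ) (J : Finset (Fin N)) : Type :=
  ∀ j : {j : Fin N // j ∈ J}, Fin (setSize n (R j.1))

/-- The index tuples `(w_J : J nonempty)`, where `w_J` ranges over a set of
`⌊2 ^ (n S_J)⌋` elements. -/
abbrev Indices {N : ℕ} (n : ℕ) (S : Sender N → ℝ) : Type :=
  ∀ J : Sender N, Fin (setSize n (S J))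

/-- The subtuple `m_J` of a message tuple `m`. -/
def restrict {N n : ℕ} {R : Fin N → ℝ} (J : Finset (Fin N)) (m : Messages n R) :
    SubMessages n R J :=
  fun j => m j.1

/-- A choice of an encoder `m_J ↦ w_J(m_J)` for each sender `J`. -/
abbrev Encoders {N : ℕ} (n : ℕ) (S : Sender N → ℝ) (R : Fin N → ℝ) : Type :=
  ∀ J : Sender N, SubMessages n R J.1 → Fin (setSize n (S J))

/-- The indices that all senders together send when the message tuple is `m`. -/
def sent {N n : ℕ} {S : Sender N → ℝ} {R : Fin N → ℝ} (c : Encoders n S R)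
    (m : Messages n R) : Indices n S :=
  fun J => c J (restrict J.1 m)

/-- A code of block length `n` for the dual index coding problem: an encoder for each sender and
one decoder, which sees all indices and outputs an estimate of the message tuple
(or `none`, when it declares an error). -/
structure Code {N : ℕ} (n : ℕ) (S : Sender N → ℝ) (R : Fin N → ℝ) where
  /-- the encoders -/
  enc : Encoders n S R
  /-- the decoder of the common receiver -/
  dec : Indices n S → Option (Messages n R)

/-- The average probability of error `P((M̂_1, …, M̂_N) ≠ (M_1, …, M_N))`, where the message tuple
is uniformly distributed. -/
def Code.errorProb {N n : ℕ} {S : Sender N → ℝ} {R : Fin N → ℝ} (C : Code n S R) : ℝ :=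
  (uniformOn (Set.univ : Set (Messages n R))).real {m | C.dec (sent C.enc m) ≠ some m}

/-- A tuple `R` of (nonnegative) rates is achievable if there is a sequence of codes whose average
probability of error tends to zero. -/
def Achievable {N : ℕ} (S : Sender N → ℝ) (R : Fin N → ℝ) : Prop :=
  (∀ j, 0 ≤ R j) ∧
    ∃ C : ∀ n : ℕ, Code n S R, Tendsto (fun n => (C n).errorProb) atTop (𝓝 0)

/-- The capacity region: the closure of the set of achievable rate tuples. -/
def capacityRegion {N : ℕ} (S : Sender N → ℝ) : Set (Fin N → ℝ) :=
  closure {R | Achievable S R}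

/-- The polymatroidal region: nonnegative tuples with
`∑_{j ∈ J} R_j ≤ ∑_{J' : J' ∩ J ≠ ∅} S_{J'}` for all `J`. -/
def rateRegion {N : ℕ} (S : Sender N → ℝ) : Set (Fin N → ℝ) :=
  {R | (∀ j, 0 ≤ R j) ∧
    ∀ J : Finset (Fin N), ∑ j ∈ J, R j ≤ ∑ J' : Sender N with (J'.1 ∩ J).Nonempty, S J'}

open Classical in
/-- Simultaneous decoding for given encoders: the decoder outputs the unique message tuple that is
consistent with all the received indices at once, and declares an error if there is no such
tuple or more than one. -/
def simultaneousDecoder {N n : ℕ} {S : Sender N → ℝ} {R : Fin N → ℝ} (c : Encoders n S R)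
    (w : Indices n S) : Option (Messages n R) :=
  if h : ∃! m : Messages n R, ∀ J, sent c m J = w J then some h.choose else none

/-- The code that consists of the given encoders and simultaneous decoding. -/
def simultaneousCode {N n : ℕ} {S : Sender N → ℝ} {R : Fin N → ℝ} (c : Encoders n S R) :
    Code n S R where
  enc := c
  dec := simultaneousDecoder c

/-- The law of the random codebook of flat coding: the indices `w_J(m_J)`, over all senders `J` and
all subtuples `m_J`, are independent, and each is uniformly distributed. -/
def flatCodebook {N : ℕ} (n : ℕ) (S : Sender N → ℝ) (R : Fin N → ℝ) :
    Measure (Encoders n S R) :=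
  Measure.pi fun J : Sender N => Measure.pi fun _ : SubMessages n R J.1 =>
    uniformOn (Set.univ : Set (Fin (setSize n (S J))))

/-- The probability of error of flat coding with simultaneous decoding, averaged over the random
codebook. -/
def flatErrorProb {N : ℕ} (n : ℕ) (S : Sender N → ℝ) (R : Fin N → ℝ) : ℝ :=
  ∫ c, (simultaneousCode c).errorProb ∂(flatCodebook n S R)

/-- A tuple of (nonnegative) rates is achievable by flat coding with simultaneous decoding. -/
def FlatAchievable {N : ℕ} (S : Sender N → ℝ) (R : Fin N → ℝ) : Prop :=
  (∀ j, 0 ≤ R j) ∧ Tendsto (fun n => flatErrorProb n S R) atTop (𝓝 0)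

end DualIndexCoding

end

/-! Both closures equal the region by a circle of inclusions: flat-achievable tuples are achievable,
achievable tuples lie in the closed set `rateRegion S`, and that set lies in the closure of the
flat-achievable tuples. Converse: given the messages outside `J`, only the senders meeting `J` carry
information about the rest, so counting (`card_correct_mul_le`) bounds the fraction of correctly
decoded tuples. If the inequality for `J` fails, this fraction decays exponentially. Achievability:
a competitor differing from the true tuple exactly on `J` survives with probability the product of
`1 / setSize n (S J')` over the senders meeting `J`, since all other senders repeat their index
anyway. A union bound sorted by `J` (`real_flatCodebook_error_le`) then tends to zero under strict
inequalities. Shrinking a tuple of the region by `t < 1` makes the needed inequalities strict. -/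

namespace DualIndexCoding

/-! ### Rounding: alphabet sizes against powers of two -/

section SetSize

lemma setSize_pos (n : ℕ) {r : ℝ} (hr : 0 ≤ r) : 0 < setSize n r :=
  Nat.floor_pos.2 (Real.one_le_rpow (by norm_num) (by positivity))

lemma setSize_zero (n : ℕ) : setSize n 0 = 1 := by simp [setSize]

lemma setSize_le (n : ℕ) (r : ℝ) : (setSize n r : ℝ) ≤ (2 : ℝ) ^ ((n : ℝ) * r) :=
  Nat.floor_le (by positivity)

/-- Rounding down a number that is at least 1 loses less than a factor 2. This is the source of
every power of 2 in front of the exponential bounds. -/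
lemma rpow_le_two_mul_setSize (n : ℕ) {r : ℝ} (hr : 0 ≤ r) :
    (2 : ℝ) ^ ((n : ℝ) * r) ≤ 2 * setSize n r := by
  have h1 : (1 : ℝ) ≤ setSize n r := by exact_mod_cast setSize_pos n hr
  have h2 : (2 : ℝ) ^ ((n : ℝ) * r) < setSize n r + 1 := Nat.lt_floor_add_one _
  linarith

lemma prod_setSize_le {ι : Type*} (s : Finset ι) (n : ℕ) (r : ι → ℝ) :
    ∏ i ∈ s, (setSize n (r i) : ℝ) ≤ (2 : ℝ) ^ ((n : ℝ) * ∑ i ∈ s, r i) := by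
  rw [Finset.mul_sum, Real.rpow_sum_of_pos (by norm_num)]
  exact Finset.prod_le_prod (fun _ _ => by positivity) fun i _ => setSize_le n (r i)

lemma rpow_le_prod_setSize {ι : Type*} (s : Finset ι) (n : ℕ) {r : ι → ℝ} (hr : ∀ i, 0 ≤ r i) :
    (2 : ℝ) ^ ((n : ℝ) * ∑ i ∈ s, r i) ≤ 2 ^ s.card * ∏ i ∈ s, (setSize n (r i) : ℝ) := by
  rw [Finset.mul_sum, Real.rpow_sum_of_pos (by norm_num), ← Finset.prod_const,
    ← Finset.prod_mul_distrib]
  exact Finset.prod_le_prod (fun _ _ => by positivity) fun i _ => rpow_le_two_mul_setSize n (hr i)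

end SetSize

lemma tendsto_rpow_mul_neg {d : ℝ} (hd : d < 0) (K : ℝ) :
    Tendsto (fun n : ℕ => K * (2 : ℝ) ^ ((n : ℝ) * d)) atTop (𝓝 0) := by
  have h : ∀ n : ℕ, (2 : ℝ) ^ ((n : ℝ) * d) = ((2 : ℝ) ^ d) ^ n := fun n => by
    rw [mul_comm, Real.rpow_mul (by norm_num), Real.rpow_natCast]
  simp_rw [h]
  simpa using (tendsto_pow_atTop_nhds_zero_of_lt_one (by positivity)
    (Real.rpow_lt_one_of_one_lt_of_neg (by norm_num) hd)).const_mul K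

lemma real_uniformOn_univ {α : Type*} [Fintype α] [MeasurableSpace α]
    [MeasurableSingletonClass α] (s : Set α) [DecidablePred (· ∈ s)] :
    (uniformOn (Set.univ : Set α)).real s
      = ((Finset.univ.filter (· ∈ s)).card : ℝ) / Fintype.card α := by
  have hs : s = ((Finset.univ.filter (· ∈ s) : Finset α) : Set α) := by ext; simp
  rw [measureReal_def, uniformOn_univ, ENNReal.toReal_div, ENNReal.toReal_natCast]
  conv_lhs => rw [hs]
  rw [Measure.count_apply_finset, ENNReal.toReal_natCast]

variable {N n : ℕ} {S : Sender N → ℝ} {R : Fin N → ℝ}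

/-! ### Converse by counting -/

section Converse

lemma card_messages : Fintype.card (Messages n R) = ∏ j, setSize n (R j) := by
  simp [Messages, Fintype.card_pi]

open Classical in
/-- Given the messages outside `J`, the correctly decoded messages are determined by the indices
of the senders that meet `J`. -/
lemma card_correct_mul_le (C : Code n S R) (J : Finset (Fin N)) :
    (Finset.univ.filter fun m : Messages n R => C.dec (sent C.enc m) = some m).card
        * ∏ j ∈ J, setSize n (R j)
      ≤ Fintype.card (Messages n R)
        * ∏ J' : Sender N with (J'.1 ∩ J).Nonempty, setSize n (S J') := by
  set A := Finset.univ.filter fun m : Messages n R => C.dec (sent C.enc m) = some m with hA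
  let f : Messages n R → SubMessages n R Jᶜ ×
      (∀ J' : {J' : Sender N // J' ∈ Finset.univ.filter
        fun J' : Sender N => (J'.1 ∩ J).Nonempty}, Fin (setSize n (S J'.1))) :=
    fun m => (restrict Jᶜ m, fun J' => sent C.enc m J'.1)
  have hf : Set.InjOn f A := by
    intro m hm m' hm' h
    simp only [hA, Finset.coe_filter, Finset.mem_univ, true_and, Set.mem_ofPred_eq] at hm hm'
    have hs : sent C.enc m = sent C.enc m' := by
      funext J'
      by_cases hJ' : (J'.1 ∩ J).Nonempty
      · exact congrFun (congrArg Prod.snd h) ⟨J', by simpa using hJ'⟩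
      -- A sender disjoint from `J` sees only messages outside `J`, which the first component of `f`
      -- fixes.
      · have : restrict J'.1 m = restrict J'.1 m' := by
          funext j
          refine congrFun (congrArg Prod.fst h) ⟨j.1, Finset.mem_compl.2 fun hj => hJ' ?_⟩
          exact ⟨j.1, Finset.mem_inter.2 ⟨j.2, hj⟩⟩
        simp only [sent, this]
    rw [hs, hm'] at hm
    exact (Option.some.inj hm).symm
  have hcard := Finset.card_le_card_of_injOn (t := Finset.univ) f (fun _ _ => Finset.mem_univ _) hf
  rw [Finset.card_univ, Fintype.card_prod, Fintype.card_pi, Fintype.card_pi] at hcard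
  simp only [Fintype.card_fin] at hcard
  rw [Finset.prod_coe_sort Jᶜ fun j => setSize n (R j),
    Finset.prod_coe_sort (Finset.univ.filter fun J' : Sender N => (J'.1 ∩ J).Nonempty)
      fun J' => setSize n (S J')] at hcard
  rw [card_messages, ← Finset.prod_mul_prod_compl J]
  calc _ ≤ _ := Nat.mul_le_mul_right _ hcard
    _ = _ := by ring

lemma card_messages_pos (n : ℕ) (hR : ∀ j, 0 ≤ R j) : 0 < Fintype.card (Messages n R) := by
  rw [card_messages]
  exact Finset.prod_pos fun j _ => setSize_pos n (hR j)

open Classical in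
lemma Code.errorProb_eq (C : Code n S R) :
    C.errorProb = ((Finset.univ.filter fun m : Messages n R =>
      C.dec (sent C.enc m) ≠ some m).card : ℝ) / Fintype.card (Messages n R) := by
  rw [Code.errorProb, real_uniformOn_univ]
  simp

open Classical in
lemma Code.one_sub_errorProb_eq (hR : ∀ j, 0 ≤ R j) (C : Code n S R) :
    1 - C.errorProb = ((Finset.univ.filter fun m : Messages n R =>
      C.dec (sent C.enc m) = some m).card : ℝ) / Fintype.card (Messages n R) := by
  have hpos : (0 : ℝ) < Fintype.card (Messages n R) := by exact_mod_cast card_messages_pos n hR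
  have h := Finset.card_filter_add_card_filter_not (s := (Finset.univ : Finset (Messages n R)))
    (fun m => C.dec (sent C.enc m) = some m)
  rw [Finset.card_univ] at h
  rw [C.errorProb_eq, eq_div_iff hpos.ne', sub_mul, div_mul_cancel₀ _ hpos.ne', ← h]
  push_cast
  ring

/-- The count in exponential form; `2 ^ J.card` pays for rounding the message sets in `J`. -/
lemma Code.one_sub_errorProb_le (hR : ∀ j, 0 ≤ R j) (C : Code n S R)
    (J : Finset (Fin N)) :
    1 - C.errorProb ≤ 2 ^ J.card * (2 : ℝ) ^ ((n : ℝ) *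
      (∑ J' : Sender N with (J'.1 ∩ J).Nonempty, S J' - ∑ j ∈ J, R j)) := by
  classical
  have hpos : (0 : ℝ) < Fintype.card (Messages n R) := by exact_mod_cast card_messages_pos n hR
  have h1 := card_correct_mul_le C J
  rw [← @Nat.cast_le ℝ] at h1
  push_cast at h1
  rw [C.one_sub_errorProb_eq hR, div_le_iff₀ hpos, mul_sub, Real.rpow_sub (by norm_num)]
  have h2 := rpow_le_prod_setSize J n hR
  have h3 := prod_setSize_le (Finset.univ.filter fun J' : Sender N => (J'.1 ∩ J).Nonempty) n S
  have hp : (0 : ℝ) < 2 ^ ((n : ℝ) * ∑ j ∈ J, R j) := by positivity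
  rw [mul_div_assoc', div_mul_eq_mul_div, le_div_iff₀ hp]
  refine (mul_le_mul_of_nonneg_left h2 (Nat.cast_nonneg _)).trans ?_
  have h4 := mul_le_mul_of_nonneg_left (h1.trans (mul_le_mul_of_nonneg_left h3 hpos.le))
    (by positivity : (0 : ℝ) ≤ 2 ^ J.card)
  rw [mul_left_comm]
  exact h4.trans_eq (by ring)

theorem Achievable.mem_rateRegion (h : Achievable S R) : R ∈ rateRegion S := by
  obtain ⟨hR, C, hC⟩ := h
  refine ⟨hR, fun J => ?_⟩
  by_contra! hJ
  have h1 := tendsto_rpow_mul_neg (sub_neg.2 hJ) (2 ^ J.card)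
  -- The success probability tends to 1 but its upper bound tends to 0, so `1 ≤ 0`.
  have h2 := le_of_tendsto_of_tendsto' (hC.const_sub 1) h1
    fun n => (C n).one_sub_errorProb_le hR J
  norm_num at h2

lemma isClosed_rateRegion (S : Sender N → ℝ) : IsClosed (rateRegion S) := by
  simp only [rateRegion, Set.ofPred_and, Set.ofPred_forall]
  refine IsClosed.inter (isClosed_iInter fun j => ?_) (isClosed_iInter fun J => ?_)
  · exact isClosed_le continuous_const (continuous_apply j)
  · exact isClosed_le (by fun_prop) continuous_const

end Converse

/-! ### Random coding and density of the flat-achievable tuples -/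

section FlatCoding

lemma isProbabilityMeasure_uniformOn_fin (n : ℕ) {r : ℝ} (hr : 0 ≤ r) :
    IsProbabilityMeasure (uniformOn (Set.univ : Set (Fin (setSize n r)))) := by
  have : Nonempty (Fin (setSize n r)) := ⟨⟨0, setSize_pos n hr⟩⟩
  exact isProbabilityMeasure_uniformOn Set.finite_univ Set.univ_nonempty

lemma isProbabilityMeasure_flatCodebook (n : ℕ) (hS : ∀ J, 0 ≤ S J) (R : Fin N → ℝ) :
    IsProbabilityMeasure (flatCodebook n S R) := by
  have := fun J => isProbabilityMeasure_uniformOn_fin n (hS J)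
  unfold flatCodebook
  infer_instance

/-- Averaging over the codebook: some codebook is at least as good as the mean. -/
theorem FlatAchievable.achievable (hS : ∀ J, 0 ≤ S J) (h : FlatAchievable S R) :
    Achievable S R := by
  refine ⟨h.1, ?_⟩
  have key : ∀ n, ∃ c : Encoders n S R,
      (simultaneousCode c).errorProb ≤ flatErrorProb n S R := fun n => by
    have := isProbabilityMeasure_flatCodebook n hS R
    exact exists_le_integral (Integrable.of_finite)
  choose c hc using key
  exact ⟨fun n => simultaneousCode (c n),
    squeeze_zero (fun n => measureReal_nonneg) hc h.2⟩

/-- Two distinct coordinates of a uniformly distributed function collide with probability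
`1 / k`. -/
lemma real_pi_uniformOn_collision {ι : Type*} [Fintype ι] {k : ℕ} (hk : 0 < k)
    {a b : ι} (hab : a ≠ b) :
    (Measure.pi fun _ : ι => uniformOn (Set.univ : Set (Fin k))).real {f | f a = f b}
      = (k : ℝ)⁻¹ := by
  classical
  have : Nonempty (Fin k) := ⟨⟨0, hk⟩⟩
  have : IsProbabilityMeasure (uniformOn (Set.univ : Set (Fin k))) :=
    isProbabilityMeasure_uniformOn Set.finite_univ Set.univ_nonempty
  -- Splitting by the common value `x` gives `k` disjoint boxes, each of probability `1 / k ^ 2`.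
  have hU : {f : ι → Fin k | f a = f b} = ⋃ x ∈ (Finset.univ : Finset (Fin k)),
      Set.pi Set.univ fun i => if i = a ∨ i = b then {x} else Set.univ := by
    ext f
    simp only [Set.mem_ofPred_eq, Finset.mem_univ, Set.iUnion_true, Set.mem_iUnion, Set.mem_pi]
    constructor
    · intro h
      refine ⟨f a, fun i _ => ?_⟩
      split_ifs with hi
      · rcases hi with rfl | rfl <;> simp [h]
      · trivial
    · rintro ⟨x, hx⟩
      have h1 := hx a (Set.mem_univ _)
      have h2 := hx b (Set.mem_univ _)
      simp only [true_or, or_true, if_true, Set.mem_singleton_iff] at h1 h2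
      rw [h1, h2]
  have hx : ∀ x : Fin k, (Measure.pi fun _ : ι => uniformOn (Set.univ : Set (Fin k))).real
      (Set.pi Set.univ fun i => if i = a ∨ i = b then {x} else Set.univ)
        = (k : ℝ)⁻¹ * (k : ℝ)⁻¹ := by
    intro x
    rw [measureReal_def, Measure.pi_pi, ENNReal.toReal_prod]
    have : ∀ i, (uniformOn (Set.univ : Set (Fin k))
        (if i = a ∨ i = b then {x} else Set.univ)).toReal
          = if i ∈ ({a, b} : Finset ι) then (k : ℝ)⁻¹ else 1 := by
      intro i
      by_cases hi : i = a ∨ i = b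
      · simp [hi, uniformOn_univ]
      · simp [hi]
    simp_rw [this]
    rw [Finset.prod_ite_mem, Finset.univ_inter, Finset.prod_const, Finset.card_pair hab, pow_two]
  rw [hU, measureReal_biUnion_finset]
  · simp_rw [hx]
    have : (k : ℝ) ≠ 0 := by positivity
    simp [this]
  · intro x _ y _ hxy
    refine Set.disjoint_left.2 fun f hf hf' => hxy ?_
    have h1 := hf a (Set.mem_univ _)
    have h2 := hf' a (Set.mem_univ _)
    simp only [true_or, if_true, Set.mem_singleton_iff] at h1 h2
    rw [← h1, ← h2]
  · exact fun x _ => (Set.toFinite _).measurableSet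

/-- The probability that two message tuples that differ exactly on `J` are sent as the same
index tuple. -/
lemma real_flatCodebook_sent_eq (hS : ∀ J, 0 ≤ S J) (m m' : Messages n R) :
    (flatCodebook n S R).real {c | ∀ J, sent c m' J = sent c m J}
      = ∏ J' : Sender N with (J'.1 ∩ Finset.univ.filter fun j => m' j ≠ m j).Nonempty,
        (setSize n (S J') : ℝ)⁻¹ := by
  have := fun J => isProbabilityMeasure_uniformOn_fin n (hS J)
  have hpi : {c : Encoders n S R | ∀ J, sent c m' J = sent c m J}
      = Set.pi Set.univ fun J : Sender N =>
        {f : SubMessages n R J.1 → Fin (setSize n (S J)) |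
          f (restrict J.1 m') = f (restrict J.1 m)} := by
    ext c
    simp [sent]
  rw [hpi, measureReal_def, flatCodebook, Measure.pi_pi, ENNReal.toReal_prod, Finset.prod_filter]
  refine Finset.prod_congr rfl fun J' _ => ?_
  rw [← measureReal_def]
  split_ifs with h
  · refine real_pi_uniformOn_collision (setSize_pos n (hS J')) fun he => ?_
    obtain ⟨j, hj⟩ := h
    rw [Finset.mem_inter, Finset.mem_filter] at hj
    exact hj.2.2 (congrFun he ⟨j, hj.1⟩)
  · have he : restrict J'.1 m' = restrict J'.1 m := by
      funext j
      by_contra hj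
      exact h ⟨j.1, Finset.mem_inter.2 ⟨j.2, Finset.mem_filter.2 ⟨Finset.mem_univ _, hj⟩⟩⟩
    simp [he]

open Classical in
-- Outside `J` such a tuple agrees with `m`, so its restriction to `J` determines it.
lemma card_filter_differ_le (n : ℕ) (m : Messages n R) (J : Finset (Fin N)) :
    (Finset.univ.filter fun m' : Messages n R =>
      (Finset.univ.filter fun j => m' j ≠ m j) = J).card ≤ ∏ j ∈ J, setSize n (R j) := by
  have hf : Set.InjOn (restrict J) ((Finset.univ.filter fun m' : Messages n R =>
      (Finset.univ.filter fun j => m' j ≠ m j) = J : Finset (Messages n R)) :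
      Set (Messages n R)) := by
    intro m₁ h₁ m₂ h₂ h
    simp only [Finset.coe_filter, Finset.mem_univ, true_and, Set.mem_ofPred_eq] at h₁ h₂
    funext j
    by_cases hj : j ∈ J
    · exact congrFun h ⟨j, hj⟩
    · have a₁ : m₁ j = m j := by
        by_contra hne
        exact hj (h₁ ▸ by simpa using hne)
      have a₂ : m₂ j = m j := by
        by_contra hne
        exact hj (h₂ ▸ by simpa using hne)
      rw [a₁, a₂]
  have hcard := Finset.card_le_card_of_injOn (t := Finset.univ) (restrict J)
    (fun _ _ => Finset.mem_univ _) hf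
  rw [Finset.card_univ, Fintype.card_pi] at hcard
  simp only [Fintype.card_fin] at hcard
  rwa [Finset.prod_coe_sort J fun j => setSize n (R j)] at hcard

lemma simultaneousDecoder_sent (c : Encoders n S R) (m : Messages n R)
    (h : ∀ m', (∀ J, sent c m' J = sent c m J) → m' = m) :
    simultaneousDecoder c (sent c m) = some m := by
  have hu : ∃! m' : Messages n R, ∀ J, sent c m' J = sent c m J := ⟨m, fun _ => rfl, h⟩
  rw [simultaneousDecoder, dif_pos hu, h _ hu.choose_spec.1]

/-- The union bound for a fixed message tuple, sorted by the set of positions in which the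
competing message tuple differs. -/
lemma real_flatCodebook_error_le (hS : ∀ J, 0 ≤ S J) (m : Messages n R) :
    (flatCodebook n S R).real {c | simultaneousDecoder c (sent c m) ≠ some m}
      ≤ ∑ J : Finset (Fin N) with J.Nonempty ∧ ∀ j ∈ J, R j ≠ 0,
        2 ^ (Finset.univ.filter fun J' : Sender N => (J'.1 ∩ J).Nonempty).card *
          (2 : ℝ) ^ ((n : ℝ) * (∑ j ∈ J, R j - ∑ J' : Sender N with (J'.1 ∩ J).Nonempty, S J'))
      := by
  classical
  have := isProbabilityMeasure_flatCodebook n hS R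
  let D : Messages n R → Finset (Fin N) := fun m' => Finset.univ.filter fun j => m' j ≠ m j
  have hsub : {c : Encoders n S R | simultaneousDecoder c (sent c m) ≠ some m}
      ⊆ ⋃ m' ∈ Finset.univ.filter (· ≠ m), {c | ∀ J, sent c m' J = sent c m J} := by
    intro c hc
    by_contra hcon
    refine hc (simultaneousDecoder_sent c m fun m' hm' => ?_)
    by_contra hne
    exact hcon (Set.mem_biUnion (by simpa using hne) hm')
  have hmaps : ∀ m' ∈ Finset.univ.filter (· ≠ m),
      D m' ∈ Finset.univ.filter fun J : Finset (Fin N) => J.Nonempty ∧ ∀ j ∈ J, R j ≠ 0 := by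
    intro m' hm'
    simp only [Finset.mem_filter, Finset.mem_univ, true_and] at hm' ⊢
    refine ⟨?_, fun j hj h0 => ?_⟩
    · obtain ⟨j, hj⟩ := Function.ne_iff.1 hm'
      exact ⟨j, by simpa [D] using hj⟩
    · have hj' : m' j ≠ m j := by simpa [D] using hj
      -- A message of rate zero has a single value, so no competitor differs there; only sets of
      -- positive-rate messages enter the bound.
      have : Subsingleton (Fin (setSize n (R j))) := by
        rw [h0, setSize_zero]
        infer_instance
      exact hj' (Subsingleton.elim _ _)
  refine (measureReal_mono hsub (measure_ne_top _ _)).trans ((measureReal_biUnion_finset_le _ _).trans ?_)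
  simp_rw [real_flatCodebook_sent_eq hS]
  rw [← Finset.sum_fiberwise_of_maps_to hmaps]
  refine Finset.sum_le_sum fun J _ => ?_
  calc _ = ∑ m' ∈ Finset.univ.filter (· ≠ m) with D m' = J,
        ∏ J' : Sender N with (J'.1 ∩ J).Nonempty, (setSize n (S J') : ℝ)⁻¹ := by
        refine Finset.sum_congr rfl fun m' hm' => ?_
        rw [← (Finset.mem_filter.1 hm').2]
    _ ≤ (∏ j ∈ J, (setSize n (R j) : ℝ)) *
        ∏ J' : Sender N with (J'.1 ∩ J).Nonempty, (setSize n (S J') : ℝ)⁻¹ := by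
        rw [Finset.sum_const, nsmul_eq_mul]
        refine mul_le_mul_of_nonneg_right ?_ (Finset.prod_nonneg fun _ _ => by positivity)
        have h := (Finset.card_le_card (Finset.filter_subset_filter (fun m' => D m' = J)
          (Finset.filter_subset (· ≠ m) Finset.univ))).trans (card_filter_differ_le n m J)
        exact_mod_cast h
    _ ≤ _ := by
        rw [mul_sub, Real.rpow_sub (by norm_num), Finset.prod_inv_distrib, ← div_eq_mul_inv,
          mul_div_assoc']
        have hP : 0 < ∏ J' : Sender N with (J'.1 ∩ J).Nonempty, (setSize n (S J') : ℝ) :=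
          Finset.prod_pos fun J' _ => by exact_mod_cast setSize_pos n (hS J')
        rw [div_le_div_iff₀ hP (by positivity), mul_comm (2 ^ _ : ℝ), mul_assoc]
        exact mul_le_mul (prod_setSize_le J n R) (rpow_le_prod_setSize _ n hS)
          (by positivity) (by positivity)

/-- Exchanging the averages over messages and codebooks reduces the error to a fixed message tuple.
-/
lemma flatErrorProb_eq (n : ℕ) (hS : ∀ J, 0 ≤ S J) (R : Fin N → ℝ) :
    flatErrorProb n S R = (∑ m : Messages n R,
      (flatCodebook n S R).real {c | simultaneousDecoder c (sent c m) ≠ some m})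
        / Fintype.card (Messages n R) := by
  classical
  have := isProbabilityMeasure_flatCodebook n hS R
  have h : ∀ c : Encoders n S R, (simultaneousCode c).errorProb
      = (∑ m : Messages n R, Set.indicator
        {c | simultaneousDecoder c (sent c m) ≠ some m} (fun _ => (1 : ℝ)) c)
          / Fintype.card (Messages n R) := by
    intro c
    rw [Code.errorProb_eq, Finset.card_filter]
    push_cast
    simp only [Set.indicator_apply, simultaneousCode, Set.mem_ofPred_eq]
    congr!
  simp_rw [flatErrorProb, h]
  rw [integral_div, integral_finsetSum _ fun _ _ => Integrable.of_finite]
  congr 1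
  refine Finset.sum_congr rfl fun m _ => ?_
  rw [integral_indicator_const _ (Set.toFinite _).measurableSet, smul_eq_mul, mul_one]

/-- Flat coding achieves every tuple that satisfies the strict inequalities for the sets of
messages of positive rate. -/
theorem flatAchievable_of_lt (hS : ∀ J, 0 ≤ S J) (hR : ∀ j, 0 ≤ R j)
    (h : ∀ J : Finset (Fin N), J.Nonempty → (∀ j ∈ J, R j ≠ 0) →
      ∑ j ∈ J, R j < ∑ J' : Sender N with (J'.1 ∩ J).Nonempty, S J') :
    FlatAchievable S R := by
  refine ⟨hR, ?_⟩
  have hlim := tendsto_finsetSum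
    (Finset.univ.filter fun J : Finset (Fin N) => J.Nonempty ∧ ∀ j ∈ J, R j ≠ 0)
    fun J hJ => tendsto_rpow_mul_neg
      (sub_neg.2 (h J (Finset.mem_filter.1 hJ).2.1 (Finset.mem_filter.1 hJ).2.2))
      (2 ^ (Finset.univ.filter fun J' : Sender N => (J'.1 ∩ J).Nonempty).card)
  rw [Finset.sum_const_zero] at hlim
  refine squeeze_zero (fun n => ?_) (fun n => ?_) hlim
  · rw [flatErrorProb_eq n hS]
    exact div_nonneg (Finset.sum_nonneg fun _ _ => measureReal_nonneg) (Nat.cast_nonneg _)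
  · have hpos : (0 : ℝ) < Fintype.card (Messages n R) := by exact_mod_cast card_messages_pos n hR
    rw [flatErrorProb_eq n hS, div_le_iff₀ hpos, mul_comm, ← nsmul_eq_mul, ← Finset.card_univ]
    exact Finset.sum_le_card_nsmul _ _ _ fun m _ => real_flatCodebook_error_le hS m

/-- The tuples achieved by flat coding are dense in the rate region. -/
theorem rateRegion_subset_closure (hS : ∀ J, 0 ≤ S J) :
    rateRegion S ⊆ closure {R | FlatAchievable S R} := by
  rintro R ⟨hR, hJ⟩
  have hlim : Tendsto (fun t : ℝ => t • R) (𝓝[<] 1) (𝓝 R) := by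
    have h : Continuous fun t : ℝ => t • R := by fun_prop
    simpa using (h.tendsto 1).mono_left nhdsWithin_le_nhds
  refine mem_closure_of_tendsto hlim ?_
  filter_upwards [Ioo_mem_nhdsLT (zero_lt_one' ℝ)] with t ht
  refine flatAchievable_of_lt hS (fun j => mul_nonneg ht.1.le (hR j)) fun J hne h0 => ?_
  -- Scaling by `t < 1` strictly lowers the rate sum only if it is positive, which nonzero rates on
  -- `J` guarantee.
  have hpos : 0 < ∑ j ∈ J, R j := Finset.sum_pos
    (fun j hj => lt_of_le_of_ne (hR j) fun h => h0 j hj (by simp [← h])) hne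
  simp only [Pi.smul_apply, smul_eq_mul]
  rw [← Finset.mul_sum]
  exact (mul_lt_of_lt_one_left hpos ht.2).trans_le (hJ J)

end FlatCoding

end DualIndexCoding

theorem proposition2 (N : ℕ) (S : DualIndexCoding.Sender N → ℝ) (hS : ∀ J, 0 ≤ S J) :
    DualIndexCoding.capacityRegion S = DualIndexCoding.rateRegion S ∧
    (∀ R : Fin N → ℝ, (∀ j, 0 ≤ R j) →
      (∀ J : Finset (Fin N), J.Nonempty →
        ∑ j ∈ J, R j < ∑ J' : DualIndexCoding.Sender N with (J'.1 ∩ J).Nonempty, S J') →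
      DualIndexCoding.FlatAchievable S R) ∧
    closure {R | DualIndexCoding.FlatAchievable S R} = DualIndexCoding.rateRegion S := by
  have hflat : {R | DualIndexCoding.FlatAchievable S R} ⊆ {R | DualIndexCoding.Achievable S R} :=
    fun R hR => hR.achievable hS
  have hconv : closure {R | DualIndexCoding.Achievable S R} ⊆ DualIndexCoding.rateRegion S :=
    closure_minimal (fun R hR => hR.mem_rateRegion) (DualIndexCoding.isClosed_rateRegion S)
  have hdense := DualIndexCoding.rateRegion_subset_closure hS
  exact ⟨hconv.antisymm (hdense.trans (closure_mono hflat)),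
    fun R hR h => DualIndexCoding.flatAchievable_of_lt hS hR fun J hJ _ => h J hJ,
    ((closure_mono hflat).trans hconv).antisymm hdense⟩
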